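/- Let $(X,\mathcal O_X)$ be an arbitrary scheme, and let $\kappa$ be any infinite cardinal such that $X$ has at most $\kappa$ affine open subsets and $|\mathcal O_X(U)|\le\kappa$ for every affine open $U\subseteq X$ (such $\kappa$ exist). An $\mathcal O_X$-module $N$ is said to be of type $\kappa$ if $\bigl|\bigsqcup_{U} N(U)\bigr|\le\kappa$, the disjoint union being over all affine open $U\subseteq X$. A quasi-coherent subsheaf $N\subseteq M$ is pure if $N(U)$ is a pure $\mathcal O_X(U)$-submodule of $M(U)$ for every affine open $U\subseteq X$, that is, $T\otimes_{\mathcal O_X(U)}N(U)\to T\otimes_{\mathcal O_X(U)}M(U)$ is injective for every $\mathcal O_X(U)$-module $T$. (1) Every quasi-coherent sheaf $M$ on $X$ can be written as a continuous chain of pure quasi-coherent subsheaves with steps of type $\kappa$: there are an ordinal $\mu$ and pure quasi-coherent subsheaves $M_\alpha\subseteq M$ for $\alpha\le\mu$ such that $M_0=0$, $M_\mu=M$, $M_\alpha\subseteq M_\beta$ for $\alpha\le\beta\le\mu$, $M_\lambda=\bigcup_{\alpha<\lambda}M_\alpha$ (the smallest submodule sheaf containing all $M_\alpha$ with $\alpha<\lambda$)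 for every limit ordinal $\lambda\le\mu$, and $M_{\alpha+1}/M_\alpha$ is of type $\kappa$ for every $\alpha<\mu$. Moreover, $M$ is the sum of its pure quasi-coherent subsheaves of type $\kappa$. (2) The category $\mathrm{Qco}(X)$ of quasi-coherent sheaves on $X$ (the full subcategory of $\mathcal O_X$-modules, with its usual addition of morphisms) is a Grothendieck category: it is abelian, has exact filtered colimits, and has a generator. -/

import Mathlib

open CategoryTheory CategoryTheory.Limits AlgebraicGeometry
open scoped TensorProduct

universe u

namespace QcoChain

/-- A submodule `N` of `M` is pure if `T ⊗ N → T ⊗ M` is injective for every `R`-module `T`. -/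
def IsPureSubmodule {R M : Type u} [CommRing R] [AddCommGroup M] [Module R M]
    (N : Submodule R M) : Prop :=
  ∀ (T : Type u) [AddCommGroup T] [Module R T], Function.Injective (N.subtype.lTensor T)

variable {X : Scheme.{u}}

/-- The `Γ(X, U)`-linear map on sections over `U` induced by a morphism of `𝒪_X`-modules. -/
noncomputable def sectionsMap {M N : X.Modules} (φ : M ⟶ N) (U : X.Opens) :
    Γ(M, U) →ₗ[Γ(X, U)] Γ(N, U) where
  toFun := φ.app U
  map_add' := map_add (φ.app U).hom
  map_smul' := fun r x => Scheme.Modules.Hom.app_smul (φ := φ) r x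

/-- `M` is of type `κ`: the disjoint union of the sets of sections of `M` over the affine open
subsets of `X` has cardinality at most `κ`. -/
def IsOfType (κ : Cardinal.{u}) (M : X.Modules) : Prop :=
  Cardinal.mk (Σ U : X.affineOpens, Γ(M, U.1)) ≤ κ

/-- An `𝒪_X`-submodule of `M` is a pure quasi-coherent subsheaf if it is quasi-coherent and its
sections over each affine open `U` form a pure `Γ(X, U)`-submodule of `Γ(M, U)`. -/
structure IsPureQuasicoherent {M : X.Modules} (N : Subobject M) : Prop where
  isQuasicoherent : (N : X.Modules).IsQuasicoherent
  isPure : ∀ U : X.affineOpens, IsPureSubmodule (LinearMap.range (sectionsMap N.arrow U.1))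

/-- `F α`, for `α ≤ μ`, is a continuous chain of pure quasi-coherent subsheaves of `M` that
starts at `0`, ends at `M`, and whose successive quotients are of type `κ`. -/
structure IsContinuousPureChain (κ : Cardinal.{u}) (M : X.Modules) (μ : Ordinal.{u})
    (F : Ordinal.{u} → Subobject M) : Prop where
  mono : Monotone F
  zero : F 0 = ⊥
  top : F μ = ⊤
  /-- at a limit ordinal the chain is the union (the supremum, as subsheaves) of what precedes -/
  continuous : ∀ α ≤ μ, Order.IsSuccLimit α → IsLUB (F '' Set.Iio α) (F α)
  pure : ∀ α ≤ μ, IsPureQuasicoherent (F α)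
  quotient : ∀ α < μ,
    IsOfType κ (cokernel (Subobject.ofLE (F α) (F (Order.succ α)) (mono (Order.le_succ α))))

/-- The category of quasi-coherent sheaves on `X`. -/
abbrev Qco (X : Scheme.{u}) : Type (u + 1) :=
  ObjectProperty.FullSubcategory (C := X.Modules) fun M => M.IsQuasicoherent

/-- The usual addition of morphisms of quasi-coherent sheaves (that of `𝒪_X`-modules). -/
noncomputable abbrev qcoPreadditive (X : Scheme.{u}) : Preadditive (Qco X) :=
  inferInstance

end QcoChain

/-! A quasi-coherent subsheaf of a quasi-coherent `M` amounts to a family of submodules of `Γ(M,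
U)`, for `U` affine, stable under restriction and such that a member over `D(f)`, times a power of
`f`, lifts to a member over `U` (`QcSubfamily`). Purity follows once finite linear systems solvable
in the big module are solvable in the submodule. Both requirements are met by closing under at most
`κ` finitary choice operations, so any `κ` sections lie in a pure family of cardinality at most `κ`
(`exists_pure_family_card_le`). This writes `M` as a sum. For the chain, the same closure is taken
in the quotients of `Γ(M, U)` by a pure family and pulled back, which enlarges that family by at
most `κ` classes (`QcSubfamily.exists_pure_ge`). Purity survives the pullback and directed unions,
so this step can be iterated transfinitely.

For (2), quasi-coherent modules are closed under kernels, cokernels and small colimits among all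
modules, whence abelianness and exact filtered colimits. Every section lies in a subsheaf of type
`κ`, and all of these are quotients of one module; the coproduct of its quasi-coherent quotients is
a generator. -/

namespace QcoChain

/-! ### Pure submodules. -/

section Pure

variable {R M : Type u} [CommRing R] [AddCommGroup M] [Module R M]

lemma exists_sum_tmul_eq_of_span_eq_top {T : Type*} [AddCommGroup T] [Module R T] {ι : Type*}
    [Fintype ι] {g : ι → T} (hg : Submodule.span R (Set.range g) = ⊤) (x : T ⊗[R] M) :
    ∃ n : ι → M, x = ∑ i, g i ⊗ₜ n i := by
  induction x with
  | zero => exact ⟨0, by simp⟩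
  | tmul t n =>
    have ht : t ∈ Submodule.span R (Set.range g) := hg ▸ Submodule.mem_top
    obtain ⟨c, rfl⟩ := (Submodule.mem_span_range_iff_exists_fun R).mp ht
    exact ⟨fun i ↦ c i • n, by simp [TensorProduct.sum_tmul, TensorProduct.smul_tmul]⟩
  | add x y hx hy =>
    obtain ⟨a, rfl⟩ := hx
    obtain ⟨b, rfl⟩ := hy
    exact ⟨a + b, by simp [TensorProduct.tmul_add, Finset.sum_add_distrib]⟩

/-- A submodule is pure if every finite system of linear equations with constants in the submodule
that is solvable in the ambient module is solvable in the submodule. -/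
theorem isPureSubmodule_of_forall_exists_solution (N : Submodule R M)
    (h : ∀ (m n : ℕ) (A : Fin m → Fin n → R) (y : Fin n → M), (∀ i, ∑ j, A i j • y j ∈ N) →
      ∃ z : Fin n → M, (∀ j, z j ∈ N) ∧ ∀ i, ∑ j, A i j • z j = ∑ j, A i j • y j) :
    IsPureSubmodule N := by
  intro T _ _
  rw [injective_iff_map_eq_zero]
  intro x hx
  -- Tensors and their vanishing are detected on finitely generated submodules of `T`: `x` comes
  -- from `J ⊗ N`, and its image in `M` already dies in `J' ⊗ M`.
  obtain ⟨J, hJ, y, rfl⟩ := Submodule.exists_fg_le_eq_rTensor_subtype x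
  have h1 : J.subtype.rTensor M (N.subtype.lTensor J y) = J.subtype.rTensor M 0 := by
    rw [map_zero, ← hx, ← LinearMap.comp_apply, ← LinearMap.comp_apply,
      LinearMap.rTensor_comp_lTensor, LinearMap.lTensor_comp_rTensor]
  obtain ⟨J', hJ', hle, h2⟩ := hJ.exists_rTensor_fg_inclusion_eq h1
  rw [map_zero] at h2
  suffices (Submodule.inclusion hle).rTensor N y = 0 by
    rw [← Submodule.subtype_comp_inclusion _ _ hle, LinearMap.rTensor_comp_apply, this, map_zero]
  have h3 : N.subtype.lTensor J' ((Submodule.inclusion hle).rTensor N y) = 0 := by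
    rw [← h2, ← LinearMap.comp_apply, ← LinearMap.comp_apply,
      LinearMap.rTensor_comp_lTensor, LinearMap.lTensor_comp_rTensor]
  generalize (Submodule.inclusion hle).rTensor N y = w at h3
  have : Module.Finite R J' := Module.Finite.iff_fg.mpr hJ'
  obtain ⟨k, g, hg⟩ := Module.Finite.exists_fin (R := R) (M := J')
  obtain ⟨n, rfl⟩ := exists_sum_tmul_eq_of_span_eq_top hg w
  simp only [map_sum, LinearMap.lTensor_tmul] at h3
  -- Equational criterion: `n i = ∑ j, A i j • y j` in `M`, where the columns of `A` are relations
  -- among the `g i`. Replacing `y` by a solution in `N` makes the same tensor vanish over `N`.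
  obtain ⟨l, A, y, hy, hA⟩ := TensorProduct.vanishesTrivially_of_sum_tmul_eq_zero R hg h3
  obtain ⟨z, hz, hz'⟩ := h k l A y fun i ↦ by rw [← hy]; exact (n i).2
  refine TensorProduct.sum_tmul_eq_zero_of_vanishesTrivially R
    ⟨l, A, fun j ↦ ⟨z j, hz j⟩, fun i ↦ Subtype.ext ?_, hA⟩
  simpa [hz'] using hy i

lemma isPureSubmodule_bot : IsPureSubmodule (⊥ : Submodule R M) := by
  intro T _ _
  exact Function.injective_of_subsingleton _

/-- The preimage in `M` of a pure submodule of `M ⧸ N`, where `N` is pure in `M`, is pure. -/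
lemma IsPureSubmodule.comap_mkQ {N : Submodule R M} (hN : IsPureSubmodule N)
    {P : Submodule R (M ⧸ N)} (hP : IsPureSubmodule P) : IsPureSubmodule (P.comap N.mkQ) := by
  intro T _ _
  rw [injective_iff_map_eq_zero]
  intro x hx
  have hle : N ≤ P.comap N.mkQ := by
    intro a ha
    simp [(Submodule.Quotient.mk_eq_zero N).mpr ha]
  let i := Submodule.inclusion hle
  let q : P.comap N.mkQ →ₗ[R] P := N.mkQ.restrict fun a ha ↦ ha
  have hq : Function.Surjective q := by
    rintro ⟨p, hp⟩
    obtain ⟨a, rfl⟩ := N.mkQ_surjective p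
    exact ⟨⟨a, hp⟩, rfl⟩
  have hex : Function.Exact i q := by
    intro a
    simp only [q, Subtype.ext_iff, LinearMap.coe_restrict_apply, Submodule.mkQ_apply,
      ZeroMemClass.coe_zero, Submodule.Quotient.mk_eq_zero, Set.mem_range, i]
    exact ⟨fun h ↦ ⟨⟨a, h⟩, rfl⟩, by rintro ⟨b, hb⟩; rw [← hb]; exact b.2⟩
  -- Purity of `P` kills the image of `x` in `T ⊗ P`, so `x` comes from `T ⊗ N`, where purity of `N`
  -- kills it.
  have h1 : q.lTensor T x = 0 := by
    apply (injective_iff_map_eq_zero _).mp (hP T)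
    have : P.subtype ∘ₗ q = N.mkQ ∘ₗ (P.comap N.mkQ).subtype := rfl
    rw [← LinearMap.lTensor_comp_apply, this, LinearMap.lTensor_comp_apply, hx, map_zero]
  obtain ⟨y, rfl⟩ := (lTensor_exact T hex hq x).mp h1
  have : y = 0 := by
    apply (injective_iff_map_eq_zero _).mp (hN T)
    rw [← hx, ← LinearMap.lTensor_comp_apply]
    rfl
  rw [this, map_zero]

/-- Every element of `T ⊗ N`, where `N` is a directed union, comes from a member of the union. -/
lemma isPureSubmodule_iSup {ι : Type*} [Nonempty ι] {N : ι → Submodule R M}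
    (hd : Directed (· ≤ ·) N) (hN : ∀ i, IsPureSubmodule (N i)) : IsPureSubmodule (⨆ i, N i) := by
  intro T _ _
  rw [injective_iff_map_eq_zero]
  intro x hx
  have : ∃ (i : ι) (y : T ⊗[R] N i), (Submodule.inclusion (le_iSup N i)).lTensor T y = x := by
    clear hx
    induction x with
    | zero => exact ⟨Classical.arbitrary ι, 0, map_zero _⟩
    | tmul t n =>
      obtain ⟨i, hi⟩ := (Submodule.mem_iSup_of_directed N hd).mp n.2
      exact ⟨i, t ⊗ₜ ⟨n, hi⟩, rfl⟩
    | add x y hx hy =>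
      obtain ⟨i, a, rfl⟩ := hx
      obtain ⟨j, b, rfl⟩ := hy
      obtain ⟨k, hik, hjk⟩ := hd i j
      refine ⟨k, (Submodule.inclusion hik).lTensor T a + (Submodule.inclusion hjk).lTensor T b, ?_⟩
      rw [map_add, ← LinearMap.lTensor_comp_apply, ← LinearMap.lTensor_comp_apply]
      rfl
  obtain ⟨i, y, rfl⟩ := this
  have : y = 0 := by
    apply (injective_iff_map_eq_zero _).mp (hN i T)
    rw [← hx, ← LinearMap.lTensor_comp_apply]
    rfl
  rw [this, map_zero]

end Pure

/-! ### Closing sets of sections under `κ` operations. -/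

section Closure

open Cardinal

/-- A set of cardinality at most `κ` lies in a subset of cardinality at most `κ` that is
closed under at most `κ` finitary operations. -/
theorem exists_closed_set_card_le {κ : Cardinal.{u}} (hκ : ℵ₀ ≤ κ) {E : Type u} (J : ℕ → Type u)
    (hJ : #(Σ n, J n) ≤ κ) (op : ∀ {n}, J n → (Fin n → E) → E) (A : Set E) (hA : #A ≤ κ) :
    ∃ C : Set E, A ⊆ C ∧ #C ≤ κ ∧ ∀ {n} (j : J n) (x : Fin n → E), (∀ i, x i ∈ C) →
      op j x ∈ C := by
  let L : FirstOrder.Language.{u, u} := ⟨J, fun _ ↦ PEmpty⟩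
  let _ : L.Structure E := ⟨fun f x ↦ op f x, fun r _ ↦ r.elim⟩
  let C := FirstOrder.Language.Substructure.closure L A
  refine ⟨C, FirstOrder.Language.Substructure.subset_closure, ?_, fun j x hx ↦ C.fun_mem j x hx⟩
  have := FirstOrder.Language.Substructure.lift_card_closure_le (L := L) (s := A)
  simp only [lift_id] at this
  exact this.trans (max_le hκ (add_le_of_le hκ hA hJ))

/-- Given at most `κ` modules over rings of cardinality at most `κ` and at most `κ` relations
between their elements, every set of at most `κ` elements lies in a family of pure submodules,
of total cardinality at most `κ`, that is closed under choosing related elements. -/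
theorem exists_pure_family_card_le {κ : Cardinal.{u}} (hκ : ℵ₀ ≤ κ) {I : Type u} (hI : #I ≤ κ)
    (R : I → Type u) [∀ i, CommRing (R i)] (hR : ∀ i, #(R i) ≤ κ)
    (Q : I → Type u) [∀ i, AddCommGroup (Q i)] [∀ i, Module (R i) (Q i)]
    {J : Type u} (hJ : #J ≤ κ) (rel : J → (Σ i, Q i) → (Σ i, Q i) → Prop)
    (A : Set (Σ i, Q i)) (hA : #A ≤ κ) :
    ∃ S : ∀ i, Submodule (R i) (Q i), (∀ x ∈ A, x.2 ∈ S x.1) ∧ (∀ i, IsPureSubmodule (S i)) ∧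
      #(Σ i, S i) ≤ κ ∧
      ∀ j x, x.2 ∈ S x.1 → (∃ y, rel j x y) → ∃ y, rel j x y ∧ y.2 ∈ S y.1 := by
  classical
  -- An index records a matrix `a` of `m` equations in `n` unknowns and a linear form `b`. The
  -- operation sends the right-hand sides to the value of `b` at a chosen solution, or to a harmless
  -- zero if there is none.
  let K (m : ℕ) : Type u := Σ i, Σ n : ℕ, (Fin m → Fin n → R i) × (Fin n → R i)
  -- `PLift (m = 1)` confines the operations choosing related elements to arity one.
  let K' (m : ℕ) : Type u := K m ⊕ PLift (m = 1) × J
  let op {m : ℕ} : K' m → (Fin m → Σ i, Q i) → Σ i, Q i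
    | .inl ⟨i, n, a, b⟩, x =>
      if h : ∃ y : Fin n → Q i, ∀ k, x k = ⟨i, ∑ l, a k l • y l⟩ then ⟨i, ∑ l, b l • h.choose l⟩
      else ⟨i, 0⟩
    | .inr (h, j), x =>
      if h' : ∃ y, rel j (x ⟨0, by simp [h.down]⟩) y then h'.choose else x ⟨0, by simp [h.down]⟩
  have hnat : #(ULift.{u} ℕ) ≤ κ := by simpa using hκ
  have hfin (n : ℕ) (T : Type u) (hT : #T ≤ κ) : #(Fin n → T) ≤ κ := by
    have : #(Fin n → T) = #T ^ n := by simp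
    rw [this]
    exact (pow_le_pow_left₀ zero_le hT n).trans (power_nat_le hκ)
  have hsig {T : Type u} (hT : #T ≤ κ) (Z : T → Type u) (hZ : ∀ t, #(Z t) ≤ κ) :
      #(Σ t, Z t) ≤ κ := by
    rw [mk_sigma]
    exact (sum_le_sum _ _ hZ).trans (by
      rw [sum_const, lift_id, lift_id]; exact mul_le_of_le hκ hT le_rfl)
  have hsign (Z : ℕ → Type u) (hZ : ∀ t, #(Z t) ≤ κ) : #(Σ t, Z t) ≤ κ :=
    (mk_congr (Equiv.ulift.{u}.sigmaCongrLeft' (β := fun n ↦ Z n.down)).symm).trans_le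
      (hsig hnat _ fun t ↦ hZ _)
  have hK : #(Σ m, K' m) ≤ κ := by
    refine hsign _ fun m ↦ ?_
    simp only [K', mk_sum, lift_id, K]
    refine add_le_of_le hκ (hsig hI _ fun i ↦ hsign _ fun n ↦ ?_) ?_
    · rw [mk_prod, lift_id, lift_id]
      exact mul_le_of_le hκ (hfin _ _ (hfin _ _ (hR i))) (hfin _ _ (hR i))
    · rw [mk_prod]
      refine mul_le_of_le hκ ?_ (by simpa using hJ)
      exact (lift_le_one_iff.mpr (le_one_iff_subsingleton.mpr inferInstance)).trans
        (one_lt_aleph0.le.trans hκ)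
  obtain ⟨C, hAC, hC, hop⟩ := exists_closed_set_card_le hκ K' hK op A hA
  -- The chosen solution does not depend on `b`, so all linear combinations of its coordinates lie
  -- in `C`. The submodule axioms and purity are instances of this.
  have hlin (i : I) (m n : ℕ) (a : Fin m → Fin n → R i) (y : Fin n → Q i)
      (hy : ∀ k, (⟨i, ∑ l, a k l • y l⟩ : Σ i, Q i) ∈ C) :
      ∃ z : Fin n → Q i, (∀ k, ∑ l, a k l • z l = ∑ l, a k l • y l) ∧
        ∀ b : Fin n → R i, (⟨i, ∑ l, b l • z l⟩ : Σ i, Q i) ∈ C := by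
    have h : ∃ z : Fin n → Q i, ∀ k, (⟨i, ∑ l, a k l • y l⟩ : Σ i, Q i) =
      ⟨i, ∑ l, a k l • z l⟩ := ⟨y, fun k ↦ rfl⟩
    refine ⟨h.choose, fun k ↦ (eq_of_heq (Sigma.mk.inj_iff.mp (h.choose_spec k)).2).symm,
      fun b ↦ ?_⟩
    have := hop (.inl ⟨i, n, a, b⟩) (fun k ↦ ⟨i, ∑ l, a k l • y l⟩) hy
    simpa only [op, dif_pos h] using this
  let S (i : I) : Submodule (R i) (Q i) :=
    { carrier := {q | (⟨i, q⟩ : Σ i, Q i) ∈ C}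
      zero_mem' := by
        obtain ⟨z, -, hz⟩ := hlin i 0 0 0 0 (fun k ↦ k.elim0)
        simpa using hz 0
      add_mem' := by
        intro p q hp hq
        -- The identity matrix forces the solution to be `(p, q)`; the form `(1, 1)` then gives the
        -- sum.
        obtain ⟨z, h, hz⟩ := hlin i 2 2 ![![1, 0], ![0, 1] ] ![p, q]
          (by intro k; fin_cases k <;> simpa)
        have h0 := h 0
        have h1 := h 1
        simp at h0 h1
        simpa [h0, h1] using hz ![1, 1]
      smul_mem' := by
        intro r q hq
        obtain ⟨z, h, hz⟩ := hlin i 1 1 ![![1] ] ![q] (by intro k; fin_cases k; simpa)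
        have h0 := h 0
        simp at h0
        simpa [h0] using hz ![r] }
  refine ⟨S, fun x hx ↦ hAC hx, fun i ↦ ?_, ?_, fun j x hx hy ↦ ?_⟩
  · refine isPureSubmodule_of_forall_exists_solution _ fun m n a y hy ↦ ?_
    obtain ⟨z, h, hz⟩ := hlin i m n a y hy
    refine ⟨z, fun l ↦ ?_, h⟩
    simpa [Pi.single_apply] using! hz (Pi.single l 1)
  · refine le_trans (mk_le_of_injective (f := fun s : Σ i, S i ↦
      (⟨⟨s.1, s.2.1⟩, s.2.2⟩ : C)) ?_) hC
    rintro ⟨i, s⟩ ⟨i', s'⟩ h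
    simp only [Subtype.mk.injEq, Sigma.mk.injEq] at h
    obtain ⟨rfl, h⟩ := h
    rw [Subtype.ext (eq_of_heq h)]
  · have := hop (n := 1) (.inr (⟨rfl⟩, j)) (fun _ ↦ x) (fun _ ↦ hx)
    simp only [op, dif_pos hy] at this
    exact ⟨_, hy.choose_spec, this⟩

end Closure

/-! ### Quasi-coherence as localization of sections over affine opens. -/

section Localizing

variable {X : Scheme.{u}}

/-- Sections of `M` over `V ≤ U` behave like the localization of those over `U` away from `f`. -/
structure IsAwayRestriction (M : X.Modules) {U V : X.Opens} (h : V ≤ U) (f : Γ(X, U)) : Prop where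
  exists_map_eq : ∀ s : Γ(M, V), ∃ (n : ℕ) (t : Γ(M, U)),
    M.presheaf.map (homOfLE h).op t = X.presheaf.map (homOfLE h).op f ^ n • s
  exists_smul_eq_zero : ∀ t : Γ(M, U), M.presheaf.map (homOfLE h).op t = 0 → ∃ n : ℕ, f ^ n • t = 0

/-- Needed because the image of `⊤` under `fromSpec` equals `U` only propositionally. -/
lemma isAwayRestriction_congr (M : X.Modules) {U V U' V' : X.Opens} (h : V ≤ U) (h' : V' ≤ U')
    (hU : U = U') (hV : V = V') (f : Γ(X, U)) (f' : Γ(X, U'))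
    (hf : f' = X.presheaf.map (homOfLE hU.ge).op f) :
    IsAwayRestriction M h f ↔ IsAwayRestriction M h' f' := by
  subst hU hV
  have : f' = f := by
    have h1 : (homOfLE (le_refl U)).op = 𝟙 _ := rfl
    rw [hf, h1]
    simp
  rw [this]

lemma map_homOfLE_map_homOfLE {U V W : X.Opens} (h : V ≤ U) (h' : W ≤ V) (f : Γ(X, U)) :
    X.presheaf.map (homOfLE h').op (X.presheaf.map (homOfLE h).op f) =
      X.presheaf.map (homOfLE (h'.trans h)).op f := by
  rw [← ConcreteCategory.comp_apply, ← Functor.map_comp]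
  rfl

lemma modules_map_homOfLE_map_homOfLE (M : X.Modules) {U V W : X.Opens} (h : V ≤ U) (h' : W ≤ V)
    (s : Γ(M, U)) :
    M.presheaf.map (homOfLE h').op (M.presheaf.map (homOfLE h).op s) =
      M.presheaf.map (homOfLE (h'.trans h)).op s := by
  rw [← ConcreteCategory.comp_apply, ← Functor.map_comp]
  rfl

lemma map_homOfLE_self {U : X.Opens} (h : U ≤ U) (f : Γ(X, U)) :
    X.presheaf.map (homOfLE h).op f = f :=
  congr($(X.presheaf.map_id _) f)

lemma modules_map_homOfLE_self (M : X.Modules) {U : X.Opens} (h : U ≤ U) (s : Γ(M, U)) :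
    M.presheaf.map (homOfLE h).op s = s :=
  congr($(M.presheaf.map_id _) s)

lemma restrictAppIso_fromSpec_smul (M : X.Modules) {U : X.Opens} (hU : IsAffineOpen U)
    (W : (Spec Γ(X, U)).Opens) (h : hU.fromSpec ''ᵁ W ≤ U) (r : Γ(X, U))
    (x : Γ(M.restrict hU.fromSpec, W)) :
    (M.restrictAppIso hU.fromSpec W).hom (r • x) =
      X.presheaf.map (homOfLE h).op r • (M.restrictAppIso hU.fromSpec W).hom x := by
  rw [Scheme.Modules.smul_Spec_def]
  refine (Scheme.Modules.smul_restrictAppIso_hom_apply _ _ _ _ _).trans ?_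
  congr 1
  simp_rw [← ConcreteCategory.comp_apply]
  congr 2
  have h2 : (Scheme.ΓSpecIso Γ(X, U)).inv = hU.fromSpec.app U ≫
      (Spec Γ(X, U)).presheaf.map (eqToHom hU.fromSpec_preimage_self.symm).op := by
    rw [hU.fromSpec_app_self]
    simp [← Functor.map_comp]
  rw [h2]
  simp [Scheme.Hom.app_eq_appLE]

lemma image_fromSpec_top {U : X.Opens} (hU : IsAffineOpen U) : hU.fromSpec ''ᵁ ⊤ = U := by
  rw [Scheme.Hom.image_top_eq_opensRange, hU.opensRange_fromSpec]

lemma image_fromSpec_le {U : X.Opens} (hU : IsAffineOpen U) (W : (Spec Γ(X, U)).Opens) :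
    hU.fromSpec ''ᵁ W ≤ U :=
  (hU.fromSpec.image_mono le_top).trans (image_fromSpec_top hU).le

/-- On `Spec R`, quasi-coherence says that restriction to each `D(f)` is localization away from `f`.
Since `f` always acts invertibly over `D(f)`, only the two conditions of `IsAwayRestriction` remain.
-/
lemma isQuasicoherent_restrict_fromSpec_iff (M : X.Modules) {U : X.Opens} (hU : IsAffineOpen U) :
    (M.restrict hU.fromSpec).IsQuasicoherent ↔
      ∀ f : Γ(X, U), IsAwayRestriction M (X.basicOpen_le f) f := by
  rw [isQuasicoherent_iff_isIso_fromTildeΓ, isIso_fromTildeΓ_iff_isLocalizing]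
  refine forall_congr' fun f ↦ ?_
  let N := M.restrict hU.fromSpec
  let D : (Spec Γ(X, U)).Opens := PrimeSpectrum.basicOpen f
  have hD : hU.fromSpec ''ᵁ D ≤ hU.fromSpec ''ᵁ ⊤ := hU.fromSpec.image_mono le_top
  let f' : Γ(X, hU.fromSpec ''ᵁ ⊤) := X.presheaf.map (homOfLE (image_fromSpec_top hU).le).op f
  let e (W : (Spec Γ(X, U)).Opens) : Γ(N, W) ≅ Γ(M, hU.fromSpec ''ᵁ W) :=
    M.restrictAppIso hU.fromSpec W
  let φ : Γ(N, ⊤) →ₗ[Γ(X, U)] Γ(N, D) :=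
    ((modulesSpecToSheaf.obj N).obj.map D.leTop.op).hom
  have hφ (x : Γ(N, ⊤)) : (e D).hom (φ x) = M.presheaf.map (homOfLE hD).op ((e ⊤).hom x) := rfl
  have hpow (W) (n : ℕ) (x : Γ(N, W)) : (e W).hom (f ^ n • x) =
      X.presheaf.map (homOfLE (image_fromSpec_le hU W)).op f ^ n • (e W).hom x := by
    rw [restrictAppIso_fromSpec_smul (h := image_fromSpec_le hU W), map_pow]
  have hbij (W) : Function.Bijective (e W).hom := ConcreteCategory.bijective_of_isIso _
  have hf' : X.presheaf.map (homOfLE hD).op f' =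
      X.presheaf.map (homOfLE (image_fromSpec_le hU D)).op f :=
    map_homOfLE_map_homOfLE _ _ _
  trans IsAwayRestriction M hD f'
  · constructor
    · intro h
      refine ⟨fun s ↦ ?_, fun t ht ↦ ?_⟩
      · obtain ⟨s, rfl⟩ := (hbij _).2 s
        obtain ⟨⟨t, ⟨_, n, rfl⟩⟩, hn⟩ := h.surj s
        have hn : f ^ n • s = φ t := hn
        refine ⟨n, (e ⊤).hom t, ?_⟩
        rw [hf', ← hpow, hn]
        exact (hφ t).symm
      · obtain ⟨t, rfl⟩ := (hbij _).2 t
        have h0 : φ t = 0 := (hbij _).1 (Eq.trans ht (map_zero (e D).hom.hom).symm)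
        obtain ⟨⟨_, n, rfl⟩, hn⟩ :=
          (have : IsLocalizedModule (.powers f) φ := h
           IsLocalizedModule.eq_zero_iff (.powers f) φ).mp h0
        have hn : f ^ n • t = 0 := hn
        refine ⟨n, (hpow ⊤ n t).symm.trans ?_⟩
        rw [hn]
        exact map_zero (e ⊤).hom.hom
    · intro h
      have hloc : IsLocalizedModule.Away f φ := by
        refine IsLocalizedModule.Away.mk_of_addCommGroup
          (N.isUnit_algebraMap_end_of_le_basicOpen f le_rfl) (fun s ↦ ?_) fun t ht ↦ ?_
        · obtain ⟨n, t, ht⟩ := h.exists_map_eq ((e _).hom s)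
          obtain ⟨t, rfl⟩ := (hbij _).2 t
          refine ⟨n, t, (hbij _).1 ?_⟩
          rw [hpow, hφ, ht, hf']
        · obtain ⟨n, hn⟩ := h.exists_smul_eq_zero ((e ⊤).hom t) (by
            rw [← hφ, ht]; exact map_zero (e D).hom.hom)
          refine ⟨n, (hbij _).1 ?_⟩
          rw [hpow]
          exact hn.trans (map_zero (e ⊤).hom.hom).symm
      exact hloc
  · exact isAwayRestriction_congr M _ _ (image_fromSpec_top hU) (hU.fromSpec_image_basicOpen f) _ _
      (by rw [map_homOfLE_map_homOfLE, map_homOfLE_self])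

/-- A module whose restriction to an affine open is quasi-coherent has a presentation there. -/
lemma nonempty_presentation_over (M : X.Modules) {U : X.Opens} (hU : IsAffineOpen U)
    (h : (M.restrict hU.fromSpec).IsQuasicoherent) :
    Nonempty (SheafOfModules.Presentation (SheafOfModules.over (R := X.ringCatSheaf) M U)) := by
  let N := (modulesSpecToSheaf.obj (M.restrict hU.fromSpec)).presheaf.obj (.op ⊤)
  have hiso : IsIso (C := SheafOfModules.{u} (Spec Γ(X, U)).ringCatSheaf)
      (M.restrict hU.fromSpec).fromTildeΓ := (isQuasicoherent_iff_isIso_fromTildeΓ _).mp h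
  have p : (M.restrict hU.fromSpec).Presentation := SheafOfModules.Presentation.ofIsIso.{u, u, u}
    (M.restrict hU.fromSpec).fromTildeΓ
    (presentationTilde.{u} N .univ (by simp) _ (Submodule.span_eq _))
  let F : SheafOfModules.{u} (Spec Γ(X, U)).ringCatSheaf ⥤
      SheafOfModules.{u} (X.ringCatSheaf.over U) :=
    Scheme.Modules.restrictFunctor hU.isoSpec.hom ⋙ (Scheme.Modules.overEquiv U).inverse
  have : PreservesColimitsOfSize.{u, u} (Scheme.Modules.restrictFunctor hU.isoSpec.hom) :=
    inferInstance
  have : PreservesColimitsOfSize.{u, u} (Scheme.Modules.overEquiv U).inverse := inferInstance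
  have : PreservesColimitsOfSize.{u, u} F :=
    comp_preservesColimits (Scheme.Modules.restrictFunctor hU.isoSpec.hom) _
  let η : F.obj (SheafOfModules.unit _) ≅ SheafOfModules.unit _ :=
    (Scheme.Modules.overEquiv U).inverse.mapIso (Scheme.Modules.restrictUnitIso _) ≪≫
      (Scheme.Modules.overEquiv U).inverse.mapIso (Iso.refl _) ≪≫
      (Scheme.Modules.overEquiv U).unitIso.symm.app (SheafOfModules.unit _)
  let iso : F.obj (M.restrict hU.fromSpec) ≅ SheafOfModules.over (R := X.ringCatSheaf) M U :=
    (Scheme.Modules.overEquiv U).inverse.mapIso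
      ((Scheme.Modules.restrictFunctorComp _ _).symm.app M ≪≫
        (Scheme.Modules.restrictFunctorCongr (by simp)).app M ≪≫
        (Scheme.Modules.overFunctorEquiv U).symm.app M) ≪≫
      (Scheme.Modules.overEquiv U).unitIso.symm.app _
  exact ⟨SheafOfModules.Presentation.ofIsIso.{u, u, u} iso.hom (p.map F η.symm)⟩

/-- Being quasi-coherent is local on affine opens. -/
lemma isQuasicoherent_iff_restrict_fromSpec (M : X.Modules) :
    M.IsQuasicoherent ↔
      ∀ (U : X.Opens) (hU : IsAffineOpen U), (M.restrict hU.fromSpec).IsQuasicoherent := by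
  refine ⟨fun h U hU ↦ inferInstance, fun h ↦ ?_⟩
  let q : SheafOfModules.QuasicoherentData.{u} (R := X.ringCatSheaf) M :=
    { I := X.affineOpens
      X := fun U ↦ U.1
      coversTop := (Opens.coversTop_iff _ _).mpr (iSup_affineOpens_eq_top X)
      presentation := fun U ↦ (nonempty_presentation_over M U.2 (h U.1 U.2)).some }
  exact q.isQuasicoherent

theorem isQuasicoherent_iff_isAwayRestriction (M : X.Modules) :
    M.IsQuasicoherent ↔ ∀ (U : X.affineOpens) (f : Γ(X, U.1)),
      IsAwayRestriction M (X.basicOpen_le f) f := by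
  rw [isQuasicoherent_iff_restrict_fromSpec, Subtype.forall]
  exact forall₂_congr fun U hU ↦ isQuasicoherent_restrict_fromSpec_iff M hU

end Localizing

/-! ### Quasi-coherent subsheaves from families over affine opens. -/

section Subsheaf

variable {X : Scheme.{u}}

lemma modules_map_smul (M : X.Modules) {U V : X.Opens} (h : V ≤ U) (r : Γ(X, U)) (s : Γ(M, U)) :
    M.presheaf.map (homOfLE h).op (r • s) =
      X.presheaf.map (homOfLE h).op r • M.presheaf.map (homOfLE h).op s :=
  M.map_smul (homOfLE h) r s

lemma hom_app_map {M N : X.Modules} (φ : M ⟶ N) {U V : X.Opens} (h : V ≤ U) (s : Γ(M, U)) :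
    φ.app V (M.presheaf.map (homOfLE h).op s) = N.presheaf.map (homOfLE h).op (φ.app U s) :=
  congr($(φ.mapPresheaf.naturality (homOfLE h).op) s)

/-- Sections that agree on the affine opens contained in `W` are equal. -/
lemma section_ext_of_affine (M : X.Modules) {W : X.Opens} {s t : Γ(M, W)}
    (h : ∀ (V : X.affineOpens) (hV : V.1 ≤ W),
      M.presheaf.map (homOfLE hV).op s = M.presheaf.map (homOfLE hV).op t) : s = t := by
  refine TopCat.Sheaf.eq_of_locally_eq' ⟨_, M.isSheaf⟩
    (fun V : {V : X.affineOpens // V.1 ≤ W} ↦ V.1.1) W (fun V ↦ homOfLE V.2) ?_ s t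
    (fun V ↦ h V.1 V.2)
  intro x hx
  obtain ⟨V, hV, hxV, hVW⟩ := TopologicalSpace.Opens.isBasis_iff_nbhd.mp X.isBasis_affineOpens hx
  exact TopologicalSpace.Opens.mem_iSup.mpr ⟨⟨⟨V, hV⟩, hVW⟩, hxV⟩

lemma hom_ext_of_affine {M N : X.Modules} {φ ψ : M ⟶ N}
    (h : ∀ (U : X.affineOpens) (s : Γ(M, U.1)), φ.app U.1 s = ψ.app U.1 s) : φ = ψ := by
  ext W s
  refine section_ext_of_affine N fun V hV ↦ ?_
  rw [← hom_app_map, ← hom_app_map, h]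

lemma app_injective_of_mono {M N : X.Modules} (φ : M ⟶ N) [Mono φ] (U : X.Opens) :
    Function.Injective (φ.app U) := by
  have h1 : Mono ((Scheme.Modules.toPresheaf X).map φ) := inferInstance
  have h2 : Mono (((Scheme.Modules.toPresheaf X).map φ).app (.op U)) := inferInstance
  exact (AddCommGrpCat.mono_iff_injective _).mp h2

/-- The sections over `U` of a subobject. -/
noncomputable def sectionsOf {M : X.Modules} (A : Subobject M) (U : X.Opens) :
    Submodule Γ(X, U) Γ(M, U) :=
  LinearMap.range (sectionsMap A.arrow U)

lemma sectionsOf_mk {M N : X.Modules} (φ : N ⟶ M) [Mono φ] (U : X.Opens) :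
    sectionsOf (Subobject.mk φ) U = LinearMap.range (sectionsMap φ U) := by
  ext s
  constructor
  · rintro ⟨t, rfl⟩
    refine ⟨(Subobject.underlyingIso φ).hom.app U t, ?_⟩
    change ((Subobject.underlyingIso φ).hom ≫ φ).app U t = _
    rw [Subobject.underlyingIso_hom_comp_eq_mk]
    rfl
  · rintro ⟨t, rfl⟩
    refine ⟨(Subobject.underlyingIso φ).inv.app U t, ?_⟩
    change ((Subobject.underlyingIso φ).inv ≫ (Subobject.mk φ).arrow).app U t = _
    rw [Subobject.underlyingIso_arrow]
    rfl

lemma sectionsOf_mono {M : X.Modules} {A B : Subobject M} (h : A ≤ B) (U : X.Opens) :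
    sectionsOf A U ≤ sectionsOf B U := by
  rintro _ ⟨t, rfl⟩
  refine ⟨(Subobject.ofLE A B h).app U t, ?_⟩
  change (Subobject.ofLE A B h ≫ B.arrow).app U t = _
  rw [Subobject.ofLE_arrow]
  rfl

/-- The composite of `A` into the cokernel of `B` vanishes on affine opens, hence is zero, and `B`
is the kernel of its cokernel. -/
lemma le_of_sectionsOf_le {M : X.Modules} {A B : Subobject M}
    (h : ∀ U : X.affineOpens, sectionsOf A U.1 ≤ sectionsOf B U.1) : A ≤ B := by
  have hz : A.arrow ≫ cokernel.π B.arrow = 0 := by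
    refine hom_ext_of_affine fun U s ↦ ?_
    obtain ⟨t, ht⟩ := h U ⟨s, rfl⟩
    change (cokernel.π B.arrow).app U.1 (A.arrow.app U.1 s) = 0
    have ht : B.arrow.app U.1 t = A.arrow.app U.1 s := ht
    rw [← ht]
    change (B.arrow ≫ cokernel.π B.arrow).app U.1 t = 0
    rw [cokernel.condition]
    rfl
  exact Subobject.le_of_comm (Abelian.monoLift B.arrow A.arrow hz) (Abelian.monoLift_comp _ _ _)

/-- A family of submodules of the sections of `M` over the affine opens that is compatible with
restriction and with localization. -/
structure QcSubfamily (M : X.Modules) where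
  obj (U : X.affineOpens) : Submodule Γ(X, U.1) Γ(M, U.1)
  map_mem {U V : X.affineOpens} (h : V.1 ≤ U.1) {s : Γ(M, U.1)} (hs : s ∈ obj U) :
    M.presheaf.map (homOfLE h).op s ∈ obj V
  exists_lift (U : X.affineOpens) (f : Γ(X, U.1)) (s : Γ(M, X.basicOpen f))
    (hs : s ∈ obj ⟨X.basicOpen f, U.2.basicOpen f⟩) : ∃ (n : ℕ), ∃ t ∈ obj U,
      M.presheaf.map (homOfLE (X.basicOpen_le f)).op t =
        X.presheaf.map (homOfLE (X.basicOpen_le f)).op f ^ n • s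

namespace QcSubfamily

variable {M : X.Modules} (S : QcSubfamily M)

/-- The sections of `M` over `W` whose restrictions to affine opens lie in the family. -/
noncomputable def sections (W : X.Opens) : Submodule Γ(X, W) Γ(M, W) where
  carrier := {s | ∀ (V : X.affineOpens) (hV : V.1 ≤ W),
    M.presheaf.map (homOfLE hV).op s ∈ S.obj V}
  zero_mem' V hV := by
    rw [map_zero]
    exact zero_mem _
  add_mem' {s t} hs ht V hV := by
    rw [map_add]
    exact add_mem (hs V hV) (ht V hV)
  smul_mem' r s hs V hV := by
    rw [modules_map_smul]
    exact Submodule.smul_mem _ _ (hs V hV)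

/-- The subpresheaf of `M` of the sections whose restrictions to affine opens lie in the family. -/
noncomputable def toSubmodule : PresheafOfModules.Submodule M.val where
  obj W := S.sections W.unop
  map {W W'} i s hs V hV := by
    have h : W'.unop ≤ W.unop := leOfHom i.unop
    have := modules_map_homOfLE_map_homOfLE M h hV s
    exact this ▸ hs V (hV.trans h)

/-- Membership in a compatible family is local. -/
lemma mem_obj_of_locally (hM : M.IsQuasicoherent) (V : X.affineOpens) (s : Γ(M, V.1))
    (h : ∀ x ∈ V.1, ∃ (W : X.Opens) (hW : W ≤ V.1), x ∈ W ∧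
      M.presheaf.map (homOfLE hW).op s ∈ S.toSubmodule.obj (.op W)) : s ∈ S.obj V := by
  -- `I` consists of the `f` with `f • s` in the family. Its radical is the unit ideal because the
  -- basic opens `D(f)` on which `s` belongs to the family cover `V`.
  let I : Ideal Γ(X, V.1) := (S.obj V).comap (LinearMap.toSpanSingleton _ _ s)
  have hI (f : Γ(X, V.1)) : f ∈ I ↔ f • s ∈ S.obj V := Iff.rfl
  suffices I = ⊤ by
    have h1 : (1 : Γ(X, V.1)) ∈ I := this ▸ Submodule.mem_top
    rwa [hI, one_smul] at h1
  rw [← Ideal.radical_eq_top, eq_top_iff, ← Ideal.span_eq I.radical, top_le_iff,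
    ← V.2.self_le_iSup_basicOpen_iff]
  intro x hx
  obtain ⟨W, hWV, hxW, hW⟩ := h x hx
  obtain ⟨f, hf, hxf⟩ := V.2.exists_basicOpen_le ⟨x, hxW⟩ hx
  refine TopologicalSpace.Opens.mem_iSup.mpr ⟨⟨f, ?_⟩, hxf⟩
  have h1 := hW ⟨X.basicOpen f, V.2.basicOpen f⟩ hf
  rw [modules_map_homOfLE_map_homOfLE] at h1
  obtain ⟨n, t, ht, htn⟩ := S.exists_lift V f _ h1
  rw [← map_pow, ← modules_map_smul] at htn
  obtain ⟨m, hm⟩ := ((isQuasicoherent_iff_isAwayRestriction M).mp hM V f).exists_smul_eq_zero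
    (t - f ^ n • s) (by rw [map_sub, htn, sub_self])
  rw [smul_sub, sub_eq_zero] at hm
  refine ⟨m + n, ?_⟩
  rw [hI, pow_add, mul_smul, ← hm]
  exact Submodule.smul_mem _ _ ht

lemma mem_toSubmodule_of_locally (hM : M.IsQuasicoherent) {W : X.Opens} (s : Γ(M, W))
    (h : ∀ x ∈ W, ∃ (W' : X.Opens) (hW : W' ≤ W), x ∈ W' ∧
      M.presheaf.map (homOfLE hW).op s ∈ S.toSubmodule.obj (.op W')) :
    s ∈ S.toSubmodule.obj (.op W) := by
  intro V hV
  refine S.mem_obj_of_locally hM V _ fun x hx ↦ ?_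
  obtain ⟨W', hW', hxW', h'⟩ := h x (hV hx)
  refine ⟨W' ⊓ V.1, inf_le_right, ⟨hxW', hx⟩, ?_⟩
  have := S.toSubmodule.map_mem (homOfLE (inf_le_left : W' ⊓ V.1 ≤ W')).op h'
  rw [modules_map_homOfLE_map_homOfLE]
  exact (modules_map_homOfLE_map_homOfLE M hW' inf_le_left s) ▸ this

lemma mem_toSubmodule_affine (U : X.affineOpens) (s : Γ(M, U.1)) :
    s ∈ S.toSubmodule.obj (.op U.1) ↔ s ∈ S.obj U := by
  refine ⟨fun h ↦ ?_, fun h V hV ↦ S.map_mem hV h⟩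
  have := h U le_rfl
  rwa [modules_map_homOfLE_self] at this

lemma isSheaf_toPresheafOfModules (hM : M.IsQuasicoherent) :
    TopCat.Presheaf.IsSheaf S.toSubmodule.toPresheafOfModules.presheaf := by
  rw [TopCat.Presheaf.isSheaf_iff_isSheafUniqueGluing]
  intro ι U sf hsf
  let sf' (i : ι) : Γ(M, U i) := (sf i).1
  obtain ⟨s, hs, huniq⟩ := TopCat.Sheaf.existsUnique_gluing ⟨_, M.isSheaf⟩ U sf'
    (fun i j ↦ congr_arg Subtype.val (hsf i j))
  have hmem : s ∈ S.toSubmodule.obj (.op (iSup U)) := by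
    refine S.mem_toSubmodule_of_locally hM s fun x hx ↦ ?_
    obtain ⟨i, hi⟩ := TopologicalSpace.Opens.mem_iSup.mp hx
    exact ⟨U i, le_iSup U i, hi, (hs i).symm ▸ (sf i).2⟩
  exact ⟨⟨s, hmem⟩, fun i ↦ Subtype.ext (hs i), fun t ht ↦
    Subtype.ext (huniq t.1 fun i ↦ congr_arg Subtype.val (ht i))⟩

/-- The subsheaf of `M` defined by a compatible family. -/
noncomputable def toModules (hM : M.IsQuasicoherent) : X.Modules where
  val := S.toSubmodule.toPresheafOfModules
  isSheaf := S.isSheaf_toPresheafOfModules hM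

/-- The inclusion of the subsheaf defined by a compatible family. -/
noncomputable def ι (hM : M.IsQuasicoherent) : S.toModules hM ⟶ M :=
  ⟨S.toSubmodule.ι⟩

instance (hM : M.IsQuasicoherent) : Mono (S.ι hM) :=
  (Scheme.Modules.toPresheafOfModules X).mono_of_mono_map
    (inferInstanceAs (Mono S.toSubmodule.ι))

lemma range_sectionsMap_ι (hM : M.IsQuasicoherent) (U : X.affineOpens) :
    LinearMap.range (sectionsMap (S.ι hM) U.1) = S.obj U := by
  ext s
  rw [← S.mem_toSubmodule_affine]
  exact ⟨by rintro ⟨t, rfl⟩; exact t.2, fun h ↦ ⟨⟨s, h⟩, rfl⟩⟩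

lemma isQuasicoherent_toModules (hM : M.IsQuasicoherent) :
    (S.toModules hM).IsQuasicoherent := by
  rw [isQuasicoherent_iff_isAwayRestriction]
  intro U f
  have hinj := app_injective_of_mono (S.ι hM)
  refine ⟨fun s ↦ ?_, fun t ht ↦ ?_⟩
  · have hs : (S.ι hM).app _ s ∈ S.obj ⟨X.basicOpen f, U.2.basicOpen f⟩ := by
      rw [← S.range_sectionsMap_ι hM]
      exact ⟨s, rfl⟩
    obtain ⟨n, t, ht, h⟩ := S.exists_lift U f _ hs
    rw [← S.range_sectionsMap_ι hM] at ht
    obtain ⟨t, rfl⟩ := ht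
    refine ⟨n, t, hinj _ ?_⟩
    rw [hom_app_map, Scheme.Modules.Hom.app_smul]
    exact h
  · obtain ⟨n, hn⟩ := ((isQuasicoherent_iff_isAwayRestriction M).mp hM U f).exists_smul_eq_zero
      ((S.ι hM).app _ t) (by rw [← hom_app_map, ht]; exact map_zero ((S.ι hM).app _).hom)
    refine ⟨n, hinj _ ?_⟩
    rw [Scheme.Modules.Hom.app_smul, hn]
    exact (map_zero ((S.ι hM).app _).hom).symm

/-- The subobject of `M` defined by a compatible family. -/
noncomputable def subobject (hM : M.IsQuasicoherent) : Subobject M :=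
  Subobject.mk (S.ι hM)

@[simp]
lemma sectionsOf_subobject (hM : M.IsQuasicoherent) (U : X.affineOpens) :
    sectionsOf (S.subobject hM) U.1 = S.obj U := by
  rw [subobject, sectionsOf_mk, range_sectionsMap_ι]

lemma isPureQuasicoherent_subobject (hM : M.IsQuasicoherent)
    (hS : ∀ U, IsPureSubmodule (S.obj U)) : IsPureQuasicoherent (S.subobject hM) where
  isQuasicoherent :=
    (SheafOfModules.isQuasicoherent X.ringCatSheaf).prop_of_iso
      (Subobject.underlyingIso (S.ι hM)).symm (S.isQuasicoherent_toModules hM)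
  isPure U := by
    have := S.sectionsOf_subobject hM U
    rw [sectionsOf] at this
    rw [this]
    exact hS U

end QcSubfamily

/-- The cardinality of a subobject, as the cardinality of its sections in the ambient module. -/
lemma isOfType_iff_sectionsOf {M : X.Modules} (κ : Cardinal.{u}) (A : Subobject M) :
    IsOfType κ (A : X.Modules) ↔ Cardinal.mk (Σ U : X.affineOpens, sectionsOf A U.1) ≤ κ := by
  rw [IsOfType, Cardinal.mk_congr (Equiv.sigmaCongrRight fun U : X.affineOpens ↦
    (LinearEquiv.ofInjective (sectionsMap A.arrow U.1)
      (app_injective_of_mono A.arrow U.1)).toEquiv)]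
  rfl

end Subsheaf

/-! ### Closure of quasi-coherent modules under (co)limits. -/

section Abelian

variable (X : Scheme.{u})

/-- The property of being a quasi-coherent module. -/
abbrev qcoProperty : ObjectProperty X.Modules := fun M ↦ M.IsQuasicoherent

variable {X}

lemma isQuasicoherent_of_iso {M N : X.Modules} (e : M ≅ N) (hM : M.IsQuasicoherent) :
    N.IsQuasicoherent :=
  (inferInstance : ObjectProperty.IsClosedUnderIsomorphisms
    (SheafOfModules.isQuasicoherent.{u} X.ringCatSheaf)).of_iso e hM

instance : (qcoProperty X).IsClosedUnderIsomorphisms :=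
  ⟨fun e h ↦ isQuasicoherent_of_iso e h⟩

instance (R : CommRingCat.{u}) (J : Type*) [Category* J]
    [HasColimitsOfShape J (ModuleCat.{u} R)] :
    (qcoProperty (Spec R)).IsClosedUnderColimitsOfShape J := by
  have h : qcoProperty (Spec R) = (tilde.functor R).essImage := by
    ext M
    exact (isQuasicoherent_iff_isIso_fromTildeΓ M).trans isIso_fromTildeΓ_iff
  have : PreservesColimitsOfShape J (tilde.functor R) := inferInstance
  have : (tilde.functor R).essImage.IsClosedUnderColimitsOfShape J := inferInstance
  rw [h]
  exact this

/-- Restriction to affine opens preserves colimits, and over `Spec R` the quasi-coherent modules are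
the essential image of the tilde functor. -/
lemma isClosedUnderColimitsOfShape_qcoProperty (J : Type*) [Category* J]
    [∀ R : CommRingCat.{u}, HasColimitsOfShape J (ModuleCat.{u} R)] :
    (qcoProperty X).IsClosedUnderColimitsOfShape J where
  colimitsOfShape_le := by
    rintro M ⟨h⟩
    refine (isQuasicoherent_iff_restrict_fromSpec M).2 fun U hU ↦ ?_
    exact (qcoProperty (Spec Γ(X, U))).prop_of_isColimit
      (isColimitOfPreserves (Scheme.Modules.restrictFunctor hU.fromSpec) h.isColimit)
      fun j ↦ (isQuasicoherent_iff_restrict_fromSpec _).1 (h.prop_diag_obj j) U hU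

instance (J : Type u) [SmallCategory J] :
    (qcoProperty X).IsClosedUnderColimitsOfShape J :=
  isClosedUnderColimitsOfShape_qcoProperty J

instance : (qcoProperty X).IsClosedUnderColimitsOfShape WalkingParallelPair :=
  isClosedUnderColimitsOfShape_qcoProperty _

instance : (qcoProperty X).IsClosedUnderColimitsOfShape (Discrete.{0} PEmpty) :=
  isClosedUnderColimitsOfShape_qcoProperty _

instance : (qcoProperty X).ContainsZero where
  exists_zero := ⟨(HasZeroObject.zero' X.Modules).zero, isZero_zero _,
    (qcoProperty X).prop_of_isColimit (F := Functor.empty X.Modules) (c := asEmptyCocone _)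
      (isZero_zero X.Modules).isInitial (by rintro ⟨⟨⟩⟩)⟩

instance : (qcoProperty X).IsClosedUnderFiniteProducts where
  isClosedUnderLimitsOfShape J _ := by
    have : (qcoProperty X).IsClosedUnderColimitsOfShape (Discrete J) :=
      isClosedUnderColimitsOfShape_qcoProperty _
    refine ObjectProperty.IsClosedUnderLimitsOfShape.mk' ?_
    rintro _ ⟨F, hF⟩
    have := Abelian.hasFiniteBiproducts (C := X.Modules)
    have e : F ≅ Discrete.functor fun j ↦ F.obj ⟨j⟩ := Discrete.natIsoFunctor
    have e' : (∐ fun j ↦ F.obj ⟨j⟩) ≅ limit F :=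
      (biproduct.isoCoproduct _).symm ≪≫ biproduct.isoProduct _ ≪≫ lim.mapIso e.symm
    exact isQuasicoherent_of_iso e' ((qcoProperty X).prop_colimit _ fun j ↦ hF _)

/-- The compatible family of the kernels, on sections, of a morphism of quasi-coherent modules. -/
noncomputable def QcSubfamily.ker {M N : X.Modules} (hM : M.IsQuasicoherent)
    (hN : N.IsQuasicoherent) (φ : M ⟶ N) : QcSubfamily M where
  obj U := LinearMap.ker (sectionsMap φ U.1)
  map_mem {U V} h s hs := by
    have hs : φ.app U.1 s = 0 := hs
    change φ.app V.1 _ = 0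
    rw [hom_app_map, hs, map_zero]
  exists_lift U f s hs := by
    have hs : φ.app (X.basicOpen f) s = 0 := hs
    obtain ⟨n, t, ht⟩ :=
      ((isQuasicoherent_iff_isAwayRestriction M).mp hM U f).exists_map_eq s
    obtain ⟨m, hm⟩ :=
      ((isQuasicoherent_iff_isAwayRestriction N).mp hN U f).exists_smul_eq_zero (φ.app U.1 t) (by
        rw [← hom_app_map, ht, Scheme.Modules.Hom.app_smul, hs, smul_zero])
    refine ⟨m + n, f ^ m • t, ?_, ?_⟩
    · change φ.app U.1 _ = 0
      rw [Scheme.Modules.Hom.app_smul, hm]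
    · rw [modules_map_smul, ht, map_pow, pow_add, mul_smul]

/-- The kernel coincides with the subobject built from the sectionwise kernels. -/
instance : (qcoProperty X).IsClosedUnderKernels where
  kernels_le := by
    rintro _ ⟨φ, k, hk, hM, hN⟩
    let S := QcSubfamily.ker hM hN φ
    have : Mono k.ι := Fork.IsLimit.mono hk
    have h : S.subobject hM = Subobject.mk k.ι := by
      refine le_antisymm ?_ (le_of_sectionsOf_le fun U ↦ ?_)
      · have hz : S.ι hM ≫ φ = 0 := hom_ext_of_affine fun U s ↦ by
          have : (S.ι hM).app U.1 s ∈ S.obj U := by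
            rw [← S.range_sectionsMap_ι hM]
            exact ⟨s, rfl⟩
          exact this
        exact Subobject.mk_le_mk_of_comm _ (KernelFork.IsLimit.lift' hk (S.ι hM) hz).2
      · rw [S.sectionsOf_subobject, sectionsOf_mk]
        rintro _ ⟨s, rfl⟩
        change (k.ι ≫ φ).app U.1 s = 0
        rw [k.condition]
        rfl
    exact isQuasicoherent_of_iso (Subobject.isoOfMkEqMk _ _ h) (S.isQuasicoherent_toModules hM)

instance : (qcoProperty X).IsClosedUnderCokernels where
  cokernels_le := by
    rintro _ ⟨φ, k, hk, hM, hN⟩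
    exact (qcoProperty X).prop_of_isColimit hk (by rintro (_ | _) <;> assumption)

end Abelian

/-! ### Surjectivity on affine sections and exact filtered colimits. -/

section Exactness

variable {X : Scheme.{u}}

/-- Up to isomorphism `φ` is the tilde of its map on global sections, and the tilde functor reflects
epimorphisms. -/
lemma surjective_app_top_of_epi {R : CommRingCat.{u}} {M N : (Spec R).Modules}
    (hM : M.IsQuasicoherent) (hN : N.IsQuasicoherent) (φ : M ⟶ N) [Epi φ] :
    Function.Surjective (φ.app ⊤) := by
  let η := Scheme.Modules.fromTildeΓNatTrans (R := R)
  have : IsIso (η.app M) := (isQuasicoherent_iff_isIso_fromTildeΓ M).mp hM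
  have : IsIso (η.app N) := (isQuasicoherent_iff_isIso_fromTildeΓ N).mp hN
  have h1 : (tilde.functor R).map (moduleSpecΓFunctor.map φ) ≫ η.app N = η.app M ≫ φ :=
    η.naturality φ
  have h2 : Epi (η.app M ≫ φ) := epi_comp _ _
  have h3 : Epi ((tilde.functor R).map (moduleSpecΓFunctor.map φ)) := by
    rw [← h1] at h2
    exact (epi_comp_iff_of_isIso _ (η.app N)).mp h2
  exact (ModuleCat.epi_iff_surjective (moduleSpecΓFunctor.map φ)).mp
    ((tilde.functor R).epi_of_epi_map h3)

/-- An epimorphism of quasi-coherent modules is surjective on sections over affine opens. -/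
lemma surjective_app_of_epi {M N : X.Modules} (hM : M.IsQuasicoherent) (hN : N.IsQuasicoherent)
    (φ : M ⟶ N) [Epi φ] (U : X.affineOpens) : Function.Surjective (φ.app U.1) := by
  have hU : IsAffineOpen U.1 := U.2
  have h := surjective_app_top_of_epi
    ((isQuasicoherent_iff_restrict_fromSpec M).mp hM U.1 hU)
    ((isQuasicoherent_iff_restrict_fromSpec N).mp hN U.1 hU)
    ((Scheme.Modules.restrictFunctor hU.fromSpec).map φ)
  have h' : Function.Surjective (φ.app (hU.fromSpec ''ᵁ ⊤)) := h
  rwa [image_fromSpec_top hU] at h'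

instance (J : Type u) [SmallCategory J] [IsFiltered J] :
    HasExactColimitsOfShape J X.PresheafOfModules := by
  let F := PresheafOfModules.toPresheaf.{u} X.ringCatSheaf.obj
  exact HasExactColimitsOfShape.domain_of_functor J F

instance (J : Type u) [SmallCategory J] [IsFiltered J] : HasExactColimitsOfShape J X.Modules :=
  (PresheafOfModules.sheafificationAdjunction (𝟙 X.ringCatSheaf.obj)).hasExactColimitsOfShape J

instance (J : Type u) [SmallCategory J] [IsFiltered J] : HasExactColimitsOfShape J (Qco X) := by
  have : PreservesFiniteLimits (qcoProperty X).ι :=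
    have := (qcoProperty X).preservesKernels_ι
    Functor.preservesFiniteLimits_of_preservesKernels _
  exact HasExactColimitsOfShape.domain_of_functor J (qcoProperty X).ι

instance : HasFilteredColimitsOfSize.{u, u} (Qco X) where
  HasColimitsOfShape _ := inferInstance

instance : AB5OfSize.{u, u} (Qco X) where
  ofShape _ := inferInstance

end Exactness

/-! ### The chain of pure subsheaves. -/

section Chain

variable {X : Scheme.{u}}

/-- Every pure compatible family can be enlarged to a pure compatible family that contains
`κ` prescribed sections, with at most `κ` new sections modulo the given ones. -/
lemma QcSubfamily.exists_pure_ge {κ : Cardinal.{u}} (hκ : Cardinal.aleph0 ≤ κ)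
    (hX : Cardinal.mk X.affineOpens ≤ κ)
    (hO : ∀ U : X.affineOpens, Cardinal.mk Γ(X, U.1) ≤ κ) {M : X.Modules}
    (hM : M.IsQuasicoherent) (S : QcSubfamily M) (hS : ∀ U, IsPureSubmodule (S.obj U))
    (A : Set (Σ U : X.affineOpens, Γ(M, U.1))) (hA : Cardinal.mk A ≤ κ) :
    ∃ P : QcSubfamily M, (∀ U, IsPureSubmodule (P.obj U)) ∧ S.obj ≤ P.obj ∧
      (∀ x ∈ A, x.2 ∈ P.obj x.1) ∧
      Cardinal.mk (Σ U, (P.obj U).map (S.obj U).mkQ) ≤ κ := by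
  let Q (U : X.affineOpens) : Type u := Γ(M, U.1) ⧸ S.obj U
  let q (U : X.affineOpens) : Γ(M, U.1) →ₗ[Γ(X, U.1)] Q U := (S.obj U).mkQ
  -- `.inl V` encodes restriction to `V`, and `.inr ⟨U, f⟩` lifting from `D(f)` up to a power of
  -- `f`, both through representatives modulo `S`.
  let rel : X.affineOpens ⊕ (Σ U : X.affineOpens, Γ(X, U.1)) → (Σ U, Q U) → (Σ U, Q U) → Prop
    | .inl V, x, y => ∃ (h : V.1 ≤ x.1.1) (t : Γ(M, x.1.1)), x.2 = q _ t ∧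
        y = ⟨V, q V (M.presheaf.map (homOfLE h).op t)⟩
    | .inr ⟨U, f⟩, x, y => ∃ s : Γ(M, X.basicOpen f),
        x = ⟨⟨X.basicOpen f, U.2.basicOpen f⟩, q _ s⟩ ∧ ∃ (n : ℕ) (t : Γ(M, U.1)),
        M.presheaf.map (homOfLE (X.basicOpen_le f)).op t =
          X.presheaf.map (homOfLE (X.basicOpen_le f)).op f ^ n • s ∧ y = ⟨U, q U t⟩
  have hJ : Cardinal.mk (X.affineOpens ⊕ (Σ U : X.affineOpens, Γ(X, U.1))) ≤ κ := by
    rw [Cardinal.mk_sum, Cardinal.lift_id, Cardinal.lift_id, Cardinal.mk_sigma]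
    refine Cardinal.add_le_of_le hκ hX ((Cardinal.sum_le_mk_mul_iSup _).trans ?_)
    exact Cardinal.mul_le_of_le hκ hX (ciSup_le' hO)
  let A' : Set (Σ U, Q U) := (fun x ↦ ⟨x.1, q x.1 x.2⟩) '' A
  obtain ⟨T, hAT, hT, hcard, hclosed⟩ := exists_pure_family_card_le hκ hX
    (fun U : X.affineOpens ↦ Γ(X, U.1)) hO Q hJ rel A'
    (Cardinal.mk_image_le.trans hA)
  refine ⟨⟨fun U ↦ (T U).comap (q U), fun {U V} h s hs ↦ ?_, fun U f s hs ↦ ?_⟩,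
    fun U ↦ (hS U).comap_mkQ (hT U), fun U s hs ↦ ?_, fun x hx ↦ hAT _ ⟨x, hx, rfl⟩, ?_⟩
  · obtain ⟨_, ⟨h', t, ht, rfl⟩, hy⟩ := hclosed (.inl V) ⟨U, q U s⟩ hs ⟨_, h, s, rfl, rfl⟩
    have h1 : s - t ∈ S.obj U := (Submodule.Quotient.eq _).mp ht
    have h2 := S.map_mem h h1
    rw [map_sub] at h2
    have h3 : q V (M.presheaf.map (homOfLE h).op s) = q V (M.presheaf.map (homOfLE h).op t) :=
      (Submodule.Quotient.eq _).mpr h2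
    change q V _ ∈ T V
    rw [h3]
    exact hy
  · obtain ⟨n, t, ht⟩ := ((isQuasicoherent_iff_isAwayRestriction M).mp hM U f).exists_map_eq s
    obtain ⟨_, ⟨s', hs', n, t, ht, rfl⟩, hy⟩ := hclosed (.inr ⟨U, f⟩)
      ⟨⟨X.basicOpen f, U.2.basicOpen f⟩, q _ s⟩ hs ⟨_, s, rfl, n, t, ht, rfl⟩
    have h1 : s - s' ∈ S.obj ⟨X.basicOpen f, U.2.basicOpen f⟩ :=
      (Submodule.Quotient.eq _).mp (eq_of_heq (Sigma.mk.inj hs').2)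
    -- The representative `s'` supplied by the closure may differ from `s`; the difference lies in
    -- `S` and is lifted there, with its own exponent `m`.
    obtain ⟨m, r, hr, hrm⟩ := S.exists_lift U f _ h1
    refine ⟨n + m, f ^ m • t + f ^ n • r, ?_, ?_⟩
    · have h2 : q U r = 0 := (Submodule.Quotient.mk_eq_zero _).mpr hr
      change q U _ ∈ T U
      rw [map_add, map_smul, map_smul, h2, smul_zero, add_zero]
      exact Submodule.smul_mem _ _ hy
    · rw [map_add, modules_map_smul, modules_map_smul, ht, hrm, map_pow, map_pow, smul_smul,
        smul_smul, ← pow_add, ← pow_add, add_comm m n, ← smul_add, add_sub_cancel]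
  · change q U s ∈ T U
    rw [show q U s = 0 from (Submodule.Quotient.mk_eq_zero _).mpr hs]
    exact zero_mem _
  · refine le_trans (Cardinal.mk_le_of_injective
      (f := Sigma.map id fun U x ↦ (⟨x.1, Submodule.map_comap_le _ _ x.2⟩ : T U)) ?_) hcard
    exact Function.injective_id.sigma_map fun U x y h ↦ Subtype.ext congr(($h).1)

/-- A family of submodules of the sections over affine opens that is pure and comes from a
quasi-coherent subsheaf. -/
structure IsPureFamily {M : X.Modules} (F : ∀ U : X.affineOpens, Submodule Γ(X, U.1) Γ(M, U.1)) :
    Prop where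
  exists_eq : ∃ S : QcSubfamily M, S.obj = F
  isPure : ∀ U, IsPureSubmodule (F U)

lemma isPureFamily_bot (M : X.Modules) :
    IsPureFamily (⊥ : ∀ U : X.affineOpens, Submodule Γ(X, U.1) Γ(M, U.1)) where
  exists_eq := ⟨⟨⊥, fun {U V} h s hs ↦ by
      rw [show s = 0 from hs, map_zero]
      exact zero_mem _, fun U f s hs ↦ ⟨0, 0, zero_mem _, by
      rw [show s = 0 from hs, map_zero, smul_zero]⟩⟩, rfl⟩
  isPure _ := isPureSubmodule_bot

lemma isPureFamily_iSup {M : X.Modules} {ι : Type*} [Nonempty ι]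
    {F : ι → ∀ U : X.affineOpens, Submodule Γ(X, U.1) Γ(M, U.1)} (hd : Directed (· ≤ ·) F)
    (hF : ∀ i, IsPureFamily (F i)) : IsPureFamily (⨆ i, F i) := by
  have hd' (U) : Directed (· ≤ ·) fun i ↦ F i U := fun i j ↦
    (hd i j).imp fun k hk ↦ ⟨hk.1 U, hk.2 U⟩
  have hmem (U) (s : Γ(M, U.1)) : s ∈ (⨆ i, F i) U ↔ ∃ i, s ∈ F i U := by
    rw [iSup_apply]
    exact Submodule.mem_iSup_of_directed _ (hd' U)
  choose S hS using fun i ↦ (hF i).exists_eq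
  refine ⟨⟨⟨⨆ i, F i, fun {U V} h s hs ↦ ?_, fun U f s hs ↦ ?_⟩, rfl⟩, fun U ↦ ?_⟩
  · obtain ⟨i, hi⟩ := (hmem _ _).mp hs
    refine (hmem _ _).mpr ⟨i, ?_⟩
    rw [← hS i] at hi ⊢
    exact (S i).map_mem h hi
  · obtain ⟨i, hi⟩ := (hmem _ _).mp hs
    rw [← hS i] at hi
    obtain ⟨n, t, ht, h⟩ := (S i).exists_lift U f s hi
    rw [hS i] at ht
    exact ⟨n, t, (hmem _ _).mpr ⟨i, ht⟩, h⟩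
  · rw [iSup_apply]
    exact isPureSubmodule_iSup (hd' U) fun i ↦ (hF i).isPure U

/-- The type of the quotient of two quasi-coherent subsheaves can be read off from the quotients
of their sections. -/
lemma isOfType_cokernel_ofLE {M : X.Modules} {κ : Cardinal.{u}} {A B : Subobject M} (h : A ≤ B)
    (hA : (A : X.Modules).IsQuasicoherent) (hB : (B : X.Modules).IsQuasicoherent)
    (hκ : Cardinal.mk (Σ U : X.affineOpens,
      (sectionsOf B U.1).map (sectionsOf A U.1).mkQ) ≤ κ) :
    IsOfType κ (cokernel (Subobject.ofLE A B h)) := by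
  have hC : (cokernel (Subobject.ofLE A B h)).IsQuasicoherent :=
    (qcoProperty X).prop_cokernel _ hA hB
  -- Sections of the cokernel lift to `B` over affine opens, and two of them coincide when their
  -- lifts agree modulo `A`.
  have hsurj (U : X.affineOpens) := surjective_app_of_epi hB hC (cokernel.π _) U
  choose lift hlift using hsurj
  let g (U : X.affineOpens) (c : Γ(cokernel (Subobject.ofLE A B h), U.1)) :
      (sectionsOf B U.1).map (sectionsOf A U.1).mkQ :=
    ⟨(sectionsOf A U.1).mkQ (B.arrow.app U.1 (lift U c)), _, ⟨lift U c, rfl⟩, rfl⟩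
  refine le_trans (Cardinal.mk_le_of_injective (f := Sigma.map id g)
    (Function.injective_id.sigma_map fun U c d hcd ↦ ?_)) hκ
  have h1 : B.arrow.app U.1 (lift U c) - B.arrow.app U.1 (lift U d) ∈ sectionsOf A U.1 :=
    (Submodule.Quotient.eq _).mp congr(($hcd).1)
  obtain ⟨a, ha⟩ := h1
  have ha : A.arrow.app U.1 a = B.arrow.app U.1 (lift U c) - B.arrow.app U.1 (lift U d) := ha
  have h2 : (Subobject.ofLE A B h).app U.1 a = lift U c - lift U d := by
    refine app_injective_of_mono B.arrow U.1 ?_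
    rw [map_sub, ← ha]
    change (Subobject.ofLE A B h ≫ B.arrow).app U.1 a = _
    rw [Subobject.ofLE_arrow]
  rw [← hlift U c, ← hlift U d, ← sub_eq_zero, ← map_sub, ← h2]
  change (Subobject.ofLE A B h ≫ cokernel.π _).app U.1 a = 0
  rw [cokernel.condition]
  rfl

/-- Every section of a quasi-coherent module over an affine open lies in a pure quasi-coherent
subsheaf of type `κ`. -/
lemma exists_isPureQuasicoherent_isOfType {κ : Cardinal.{u}} (hκ : Cardinal.aleph0 ≤ κ)
    (hX : Cardinal.mk X.affineOpens ≤ κ)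
    (hO : ∀ U : X.affineOpens, Cardinal.mk Γ(X, U.1) ≤ κ) {M : X.Modules}
    (hM : M.IsQuasicoherent) (U : X.affineOpens) (s : Γ(M, U.1)) :
    ∃ N : Subobject M, IsPureQuasicoherent N ∧ IsOfType κ (N : X.Modules) ∧
      s ∈ sectionsOf N U.1 := by
  obtain ⟨⟨S, hS⟩, hp⟩ := isPureFamily_bot M
  obtain ⟨P, hP, -, hmem, hcard⟩ := S.exists_pure_ge hκ hX hO hM (by rwa [hS]) {⟨U, s⟩}
    (by rw [Cardinal.mk_singleton]; exact Cardinal.one_le_aleph0.trans hκ)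
  refine ⟨P.subobject hM, P.isPureQuasicoherent_subobject hM hP, ?_, ?_⟩
  · rw [isOfType_iff_sectionsOf]
    let g (V : X.affineOpens) (x : sectionsOf (P.subobject hM) V.1) :
        (P.obj V).map (S.obj V).mkQ :=
      ⟨(S.obj V).mkQ x.1, x.1, (P.sectionsOf_subobject hM V).le x.2, rfl⟩
    have hg (V) : Function.Injective (g V) := fun x y hxy ↦ by
      have h1 : x.1 - y.1 ∈ S.obj V := (Submodule.Quotient.eq _).mp congr(($hxy).1)
      rw [hS] at h1
      exact Subtype.ext (sub_eq_zero.mp h1)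
    exact (Cardinal.mk_le_of_injective (Function.injective_id.sigma_map hg)).trans hcard
  · rw [P.sectionsOf_subobject]
    exact hmem _ rfl

lemma isLUB_isPureQuasicoherent_isOfType {κ : Cardinal.{u}} (hκ : Cardinal.aleph0 ≤ κ)
    (hX : Cardinal.mk X.affineOpens ≤ κ)
    (hO : ∀ U : X.affineOpens, Cardinal.mk Γ(X, U.1) ≤ κ) {M : X.Modules}
    (hM : M.IsQuasicoherent) :
    IsLUB {N : Subobject M | IsPureQuasicoherent N ∧ IsOfType κ (N : X.Modules)} ⊤ := by
  refine ⟨fun _ _ ↦ le_top, fun B hB ↦ le_of_sectionsOf_le fun U s _ ↦ ?_⟩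
  obtain ⟨N, h1, h2, hs⟩ := exists_isPureQuasicoherent_isOfType hκ hX hO hM U s
  exact sectionsOf_mono (hB ⟨h1, h2⟩) _ hs

lemma exists_isContinuousPureChain {κ : Cardinal.{u}} (hκ : Cardinal.aleph0 ≤ κ)
    (hX : Cardinal.mk X.affineOpens ≤ κ)
    (hO : ∀ U : X.affineOpens, Cardinal.mk Γ(X, U.1) ≤ κ) {M : X.Modules}
    (hM : M.IsQuasicoherent) :
    ∃ (μ : Ordinal.{u}) (F : Ordinal.{u} → Subobject M), IsContinuousPureChain κ M μ F := by
  -- The iteration runs in the complete lattice of all families, whose suprema are openwise; purity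
  -- is then proved by induction.
  let L := ∀ U : X.affineOpens, Submodule Γ(X, U.1) Γ(M, U.1)
  have step (F : L) : ∃ G : L, F ≤ G ∧ (F ≠ ⊤ → F ≠ G) ∧ (IsPureFamily F →
      IsPureFamily G ∧ Cardinal.mk (Σ U, (G U).map (F U).mkQ) ≤ κ) := by
    by_cases hF : IsPureFamily F
    · obtain ⟨⟨S, rfl⟩, hS⟩ := hF
      obtain ⟨A, hA, hSA⟩ : ∃ A : Set (Σ U : X.affineOpens, Γ(M, U.1)), Cardinal.mk A ≤ κ ∧
          (S.obj ≠ ⊤ → ∃ x ∈ A, x.2 ∉ S.obj x.1) := by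
        by_cases htop : S.obj = ⊤
        · exact ⟨∅, by simp, fun h ↦ (h htop).elim⟩
        · obtain ⟨U, hU⟩ : ∃ U, S.obj U ≠ ⊤ := by
            by_contra! h
            exact htop (funext h)
          obtain ⟨s, hs⟩ : ∃ s, s ∉ S.obj U := by
            by_contra! h
            exact hU (eq_top_iff.mpr fun s _ ↦ h s)
          exact ⟨{⟨U, s⟩}, by
            rw [Cardinal.mk_singleton]; exact Cardinal.one_le_aleph0.trans hκ,
            fun _ ↦ ⟨_, rfl, hs⟩⟩
      obtain ⟨P, hP, hSP, hAP, hcard⟩ := S.exists_pure_ge hκ hX hO hM hS A hA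
      refine ⟨P.obj, hSP, fun htop heq ↦ ?_, fun _ ↦ ⟨⟨⟨P, rfl⟩, hP⟩, hcard⟩⟩
      obtain ⟨x, hx, hxS⟩ := hSA htop
      exact hxS (heq ▸ hAP x hx)
    -- A default making the step total; the iteration from `⊥` only meets pure families.
    · exact ⟨⊤, le_top, id, fun h ↦ (hF h).elim⟩
  choose φ hφ hne hpure using step
  let F (α : Ordinal.{u}) : L := transfiniteIterate φ α ⊥
  have hmono : Monotone F := monotone_transfiniteIterate φ ⊥ hφ
  have hzero : F 0 = ⊥ := by
    rw [← Ordinal.bot_eq_zero]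
    exact transfiniteIterate_bot φ ⊥
  have hsucc (α) : F (Order.succ α) = φ (F α) := transfiniteIterate_succ φ ⊥ α (not_isMax α)
  have hlim (α) (hα : Order.IsSuccLimit α) : F α = ⨆ β : Set.Iio α, F β.1 :=
    transfiniteIterate_limit φ ⊥ α hα
  -- The step is strictly increasing below `⊤`, and the ordinals do not inject into `L`.
  obtain ⟨μ, hμ⟩ : ∃ μ, F μ = ⊤ := top_mem_range_transfiniteIterate φ ⊥
    (fun G hG ↦ lt_of_le_of_ne (hφ G) (hne G hG)) (top_le_iff.mp (hφ ⊤))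
    (not_injective_of_ordinal F)
  have hF (α) : IsPureFamily (F α) := by
    induction α using SuccOrder.limitRecOn with
    | isMin α hα =>
      rw [hα.eq_bot, Ordinal.bot_eq_zero, hzero]
      exact isPureFamily_bot M
    | succ α _ ih =>
      rw [hsucc]
      exact (hpure _ ih).1
    | isSuccLimit α hα ih =>
      rw [hlim α hα]
      have : Nonempty (Set.Iio α) := hα.nonempty_Iio.to_subtype
      exact isPureFamily_iSup (hmono.comp (Subtype.mono_coe _)).directed_le fun β ↦ ih β.1 β.2
  choose S hS using fun α ↦ (hF α).exists_eq
  have hsec (α) (U : X.affineOpens) : sectionsOf ((S α).subobject hM) U.1 = F α U := by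
    rw [QcSubfamily.sectionsOf_subobject, hS]
  have hpq (α) : IsPureQuasicoherent ((S α).subobject hM) :=
    (S α).isPureQuasicoherent_subobject hM (by rw [hS]; exact (hF α).isPure)
  have hmono' : Monotone fun α ↦ (S α).subobject hM := fun α β h ↦
    le_of_sectionsOf_le fun U ↦ by
      rw [hsec, hsec]
      exact hmono h U
  refine ⟨μ, fun α ↦ (S α).subobject hM, hmono', ?_, ?_, fun α _ hα ↦ ⟨?_, fun B hB ↦ ?_⟩,
    fun α _ ↦ hpq α, fun α _ ↦ ?_⟩
  · refine le_bot_iff.mp (le_of_sectionsOf_le fun U ↦ ?_)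
    rw [hsec, hzero]
    exact bot_le
  · refine top_le_iff.mp (le_of_sectionsOf_le fun U ↦ ?_)
    rw [hsec, hμ]
    exact le_top
  · rintro _ ⟨β, hβ, rfl⟩
    exact hmono' (le_of_lt hβ)
  · refine le_of_sectionsOf_le fun U ↦ ?_
    rw [hsec, hlim α hα, iSup_apply]
    refine iSup_le fun β ↦ ?_
    rw [← hsec]
    exact sectionsOf_mono (hB ⟨β.1, β.2, rfl⟩) _
  · refine isOfType_cokernel_ofLE _ (hpq _).isQuasicoherent (hpq _).isQuasicoherent ?_
    have h := (hpure (F α) (hF α)).2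
    have hsec' (β) : (fun U : X.affineOpens ↦ sectionsOf ((S β).subobject hM) U.1) = F β :=
      funext (hsec β)
    rw [← hsucc, ← hsec' α, ← hsec' (Order.succ α)] at h
    exact h

end Chain

/-! ### A generator. -/

section Separator

variable {X : Scheme.{u}}

/-- Sections over `U` are corepresentable. -/
lemma exists_corepresentable_sections (U : X.Opens) :
    ∃ (G : X.Modules) (e : Γ(G, U)), ∀ (M : X.Modules) (s : Γ(M, U)),
      ∃ φ : G ⟶ M, φ.app U e = s := by
  -- `G` is the sheafification of the free presheaf of modules on the presheaf represented by `U`.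
  let adj := Adjunction.ofIsRightAdjoint (Scheme.Modules.toPresheafOfModules X)
  let Y := (PresheafOfModules.free X.ringCatSheaf.obj).obj (yoneda.obj U)
  let E {M : PresheafOfModules X.ringCatSheaf.obj} : (Y ⟶ M) ≃ M.obj (.op U) :=
    PresheafOfModules.freeYonedaEquiv
  refine ⟨_, E (adj.unit.app Y), fun M s ↦ ?_⟩
  let t : Y ⟶ (Scheme.Modules.toPresheafOfModules X).obj M := E.symm s
  refine ⟨(adj.homEquiv Y M).symm t, ?_⟩
  have h : adj.unit.app Y ≫
      (Scheme.Modules.toPresheafOfModules X).map ((adj.homEquiv Y M).symm t) = t :=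
    (adj.homEquiv_unit _ _ _).symm.trans ((adj.homEquiv Y M).apply_symm_apply t)
  have h' := congrArg E h
  exact h'.trans (E.apply_symm_apply s)

/-- All modules of type `κ` are quotients of a single module. -/
lemma exists_epi_of_isOfType (κ : Cardinal.{u}) :
    ∃ G : X.Modules, ∀ N : X.Modules, IsOfType κ N → ∃ π : G ⟶ N, Epi π := by
  choose G e hG using exists_corepresentable_sections (X := X)
  let H (i : X.affineOpens × κ.out) : X.Modules := G i.1.1
  refine ⟨∐ H, fun N hN ↦ ?_⟩
  have hsurj (U : X.affineOpens) : ∃ q : κ.out → Γ(N, U.1), Function.Surjective q := by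
    have h : Cardinal.mk Γ(N, U.1) ≤ Cardinal.mk κ.out := by
      rw [Cardinal.mk_out]
      exact (Cardinal.mk_le_of_injective (sigma_mk_injective (i := U))).trans hN
    obtain ⟨f⟩ := h
    exact ⟨Function.invFun f, Function.invFun_surjective f.injective⟩
  choose q hq using hsurj
  choose φ hφ using fun i : X.affineOpens × κ.out ↦ hG i.1.1 N (q i.1 i.2)
  refine ⟨Sigma.desc φ, ⟨fun a b hab ↦ hom_ext_of_affine fun U s ↦ ?_⟩⟩
  obtain ⟨k, rfl⟩ := hq U s
  have h : φ (U, k) ≫ a = φ (U, k) ≫ b := by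
    rw [← Sigma.ι_desc φ (U, k), Category.assoc, Category.assoc, hab]
  rw [← hφ (U, k)]
  exact congr(($h).app U.1 (e U.1))

instance (M : X.Modules) : Small.{u} (Subobject M) := by
  refine small_of_injective
    (f := fun (A : Subobject M) (U : X.affineOpens) ↦ sectionsOf A U.1) fun A B h ↦ ?_
  exact le_antisymm (le_of_sectionsOf_le fun U ↦ (congrFun h U).le)
    (le_of_sectionsOf_le fun U ↦ (congrFun h U).ge)

/-- An epimorphism exhibits its target as the cokernel of its kernel subobject. -/
lemma nonempty_cokernel_kernelSubobject_arrow_iso {G N : X.Modules} (π : G ⟶ N) [Epi π] :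
    Nonempty (cokernel (kernelSubobject π).arrow ≅ N) :=
  ⟨(cokernelIsCokernel _).coconePointUniqueUpToIso (Abelian.epiIsCokernelOfKernel _
    (kernel.isoKernel π _ (kernelSubobjectIso π) (kernelSubobject_arrow π)))⟩

instance : HasSeparator (Qco X) := by
  let κ : Cardinal.{u} := Cardinal.aleph0 + Cardinal.mk X.affineOpens +
    Cardinal.mk (Σ U : X.affineOpens, Γ(X, U.1))
  have hκ : Cardinal.aleph0 ≤ κ := le_self_add.trans le_self_add
  have hX : Cardinal.mk X.affineOpens ≤ κ := le_add_self.trans le_self_add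
  have hO (U : X.affineOpens) : Cardinal.mk Γ(X, U.1) ≤ κ :=
    (Cardinal.mk_le_of_injective (sigma_mk_injective (i := U))).trans le_add_self
  obtain ⟨G, hG⟩ := exists_epi_of_isOfType (X := X) κ
  -- `G` itself need not be quasi-coherent, so the generator is assembled from its quasi-coherent
  -- quotients, indexed by a small set of subobjects.
  let I := {A : Subobject G // (cokernel A.arrow).IsQuasicoherent}
  let Q (i : I) : Qco X := ⟨_, i.2⟩
  let H (i : Shrink.{u} I) : Qco X := Q ((equivShrink I).symm i)
  refine ⟨∐ H, ObjectProperty.IsSeparating.isSeparator_coproduct fun M N f g hfg ↦ ?_⟩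
  refine (qcoProperty X).hom_ext (hom_ext_of_affine fun U s ↦ ?_)
  -- The section lies in some `A` of type `κ`, which is isomorphic to one of these quotients, so `f`
  -- and `g` agree on `A`.
  obtain ⟨A, hA, hAκ, s, rfl⟩ := exists_isPureQuasicoherent_isOfType hκ hX hO M.2 U s
  obtain ⟨π, hπ⟩ := hG _ hAκ
  obtain ⟨e⟩ := nonempty_cokernel_kernelSubobject_arrow_iso π
  let i : I := ⟨kernelSubobject π, isQuasicoherent_of_iso e.symm hA.isQuasicoherent⟩
  have hC : ObjectProperty.ofObj H (Q i) := by
    rw [← (equivShrink I).symm_apply_apply i]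
    exact ObjectProperty.ofObj_apply H _
  have h : (e.hom ≫ A.arrow) ≫ f.hom = (e.hom ≫ A.arrow) ≫ g.hom :=
    congr(($(hfg (Q i) hC (ObjectProperty.homMk (e.hom ≫ A.arrow)))).hom)
  rw [Category.assoc, Category.assoc, cancel_epi] at h
  exact congr(($h).app U.1 s)

end Separator

instance (X : Scheme.{u}) : IsGrothendieckAbelian.{u} (Qco X) where

end QcoChain

theorem mainTheorem5 (X : Scheme.{u}) :
    (∀ κ : Cardinal.{u}, Cardinal.aleph0 ≤ κ →
      Cardinal.mk X.affineOpens ≤ κ →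
      (∀ U : X.affineOpens, Cardinal.mk Γ(X, U.1) ≤ κ) →
      ∀ M : X.Modules, M.IsQuasicoherent →
        (∃ (μ : Ordinal.{u}) (F : Ordinal.{u} → Subobject M),
          QcoChain.IsContinuousPureChain κ M μ F) ∧
        IsLUB {N : Subobject M |
          QcoChain.IsPureQuasicoherent N ∧ QcoChain.IsOfType κ (N : X.Modules)} ⊤) ∧
    ∃ A : Abelian (QcoChain.Qco X),
      A.toPreadditive = QcoChain.qcoPreadditive X ∧
      IsGrothendieckAbelian.{u} (QcoChain.Qco X) :=
  ⟨fun _ hκ hX hO _ hM ↦ ⟨QcoChain.exists_isContinuousPureChain hκ hX hO hM,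
    QcoChain.isLUB_isPureQuasicoherent_isOfType hκ hX hO hM⟩, inferInstance, rfl, inferInstance⟩
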